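/- Let $H$ be a real or complex Hilbert space. For a linear operator $T$ on $H$ with domain $D(T)$ let $R(T)$ be its range; products of operators are taken on their natural domains, $D(ST)=\{x\in D(T): Tx\in D(S)\}$. A densely defined closed linear operator $T$ on $H$ is called EP if $R(T)$ is closed and $R(T)=R(T^*)$. An operator $S$ on $H$ is called positive if $S=S^*$ and $\langle Sx,x\rangle\ge 0$ for all $x\in D(S)$. The modulus $|A|=(A^*A)^{1/2}$ of a densely defined closed operator $A$ is the unique positive operator $S$ with $S^2=A^*A$. Let $A$ be a densely defined closed linear operator on $H$ with closed range. If $A$ is EP, then the following hold (where being EP includes being densely defined, closed, and with closed range): 1. $A^*$ is EP. 2. $AA^*$ is EP. 3. $A^*A$ is EP. 4. The modulus $|A|$ is well defined (there is exactly one positive operator $S$ on $H$ with $S^2=A^*A$), and it is EP. -/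

import Mathlib

open scoped LinearPMap

namespace EPOperator

/-- The product `g f` of two partially defined operators on its natural domain
`{x ∈ D(f) | f x ∈ D(g)}`. -/
def prod {𝕜 E F G : Type*} [Ring 𝕜] [AddCommGroup E] [Module 𝕜 E] [AddCommGroup F] [Module 𝕜 F]
    [AddCommGroup G] [Module 𝕜 G] (g : F →ₗ.[𝕜] G) (f : E →ₗ.[𝕜] F) : E →ₗ.[𝕜] G where
  domain := (g.domain.comap f.toFun).map f.domain.subtype
  toFun :=
    { toFun := fun x => g ⟨f ⟨x.1, by
          obtain ⟨y, -, hy⟩ := x.2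
          exact hy ▸ y.2⟩, by
          obtain ⟨_, y, hy, rfl⟩ := x
          exact hy⟩
      map_add' := fun x y => by
        rw [← LinearPMap.map_add]
        congr 1
        apply Subtype.ext
        exact LinearPMap.map_add f ⟨x.1, _⟩ ⟨y.1, _⟩
      map_smul' := fun c x => by
        rw [RingHom.id_apply, ← LinearPMap.map_smul]
        congr 1
        apply Subtype.ext
        exact LinearPMap.map_smul f c ⟨x.1, _⟩ }

theorem mem_prod_domain {𝕜 E F G : Type*} [Ring 𝕜] [AddCommGroup E] [Module 𝕜 E]
    [AddCommGroup F] [Module 𝕜 F] [AddCommGroup G] [Module 𝕜 G]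
    (g : F →ₗ.[𝕜] G) (f : E →ₗ.[𝕜] F) (x : E) :
    x ∈ (prod g f).domain ↔ ∃ h : x ∈ f.domain, f ⟨x, h⟩ ∈ g.domain := by
  constructor
  · rintro ⟨y, hy, rfl⟩
    exact ⟨y.2, hy⟩
  · rintro ⟨h, hx⟩
    exact ⟨⟨x, h⟩, hx, rfl⟩

theorem prod_apply {𝕜 E F G : Type*} [Ring 𝕜] [AddCommGroup E] [Module 𝕜 E]
    [AddCommGroup F] [Module 𝕜 F] [AddCommGroup G] [Module 𝕜 G]
    (g : F →ₗ.[𝕜] G) (f : E →ₗ.[𝕜] F) (x : (prod g f).domain)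
    (h : (x : E) ∈ f.domain) (h' : f ⟨x, h⟩ ∈ g.domain) :
    prod g f x = g ⟨f ⟨x, h⟩, h'⟩ := rfl

/-- The range of a partially defined operator. -/
def range {𝕜 E F : Type*} [Ring 𝕜] [AddCommGroup E] [Module 𝕜 E] [AddCommGroup F] [Module 𝕜 F]
    (A : E →ₗ.[𝕜] F) : Submodule 𝕜 F :=
  LinearMap.range A.toFun

/-- An EP operator on a Hilbert space: densely defined, closed (closed graph), with closed range
equal to the range of the adjoint. -/
structure IsEP {𝕜 H : Type*} [RCLike 𝕜] [NormedAddCommGroup H] [InnerProductSpace 𝕜 H]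
    [CompleteSpace H] (A : H →ₗ.[𝕜] H) : Prop where
  dense_domain : Dense (A.domain : Set H)
  isClosed : A.IsClosed
  isClosed_range : IsClosed (range A : Set H)
  range_eq : range A = range A†

/-- A positive operator: self-adjoint with nonnegative quadratic form. The form of a self-adjoint
operator is real valued, so it is enough to look at the real part. -/
structure IsPositive {𝕜 H : Type*} [RCLike 𝕜] [NormedAddCommGroup H] [InnerProductSpace 𝕜 H]
    [CompleteSpace H] (S : H →ₗ.[𝕜] H) : Prop where
  isSelfAdjoint : IsSelfAdjoint S
  re_inner_nonneg : ∀ x : S.domain, 0 ≤ RCLike.re (inner 𝕜 (S x) (x : H))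

/-- `S` is a positive square root of `T`: it is positive and `S S = T`, including equality of
the domains. -/
structure IsPositiveSqrt {𝕜 H : Type*} [RCLike 𝕜] [NormedAddCommGroup H] [InnerProductSpace 𝕜 H]
    [CompleteSpace H] (S T : H →ₗ.[𝕜] H) : Prop where
  isPositive : IsPositive S
  prod_self : prod S S = T

/-- `S` is the modulus `|A| = (A* A)^{1/2}`. -/
def IsModulus {𝕜 H : Type*} [RCLike 𝕜] [NormedAddCommGroup H] [InnerProductSpace 𝕜 H]
    [CompleteSpace H] (S A : H →ₗ.[𝕜] H) : Prop :=
  IsPositiveSqrt S (prod A† A)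

end EPOperator

namespace EPOperator

/-- The coefficients of the power series of `1 - √(1 - x)`, from degree one on. -/
noncomputable def sqrtCoeff (n : ℕ) : ℝ := 2 * catalan n / 4 ^ (n + 1)

theorem sqrtCoeff_nonneg (n : ℕ) : 0 ≤ sqrtCoeff n := by
  unfold sqrtCoeff; positivity

theorem sqrtCoeff_eq_sub (n : ℕ) :
    sqrtCoeff n = n.centralBinom / 4 ^ n - (n + 1).centralBinom / 4 ^ (n + 1) := by
  have h1 : ((n : ℝ) + 1) * catalan n = n.centralBinom := by
    exact_mod_cast succ_mul_catalan_eq_centralBinom n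
  have h2 : ((n : ℝ) + 1) * (n + 1).centralBinom = 2 * (2 * n + 1) * n.centralBinom := by
    exact_mod_cast Nat.succ_mul_centralBinom_succ n
  have h3 : ((n + 1).centralBinom : ℝ) = 2 * (2 * n + 1) * catalan n := by
    have hn : (n : ℝ) + 1 ≠ 0 := by positivity
    apply mul_left_cancel₀ hn
    rw [h2, ← h1]; ring
  rw [sqrtCoeff, h3, ← h1, pow_succ]
  field_simp
  ring

theorem sum_sqrtCoeff_le_one (N : ℕ) : ∑ n ∈ Finset.range N, sqrtCoeff n ≤ 1 := by
  simp_rw [sqrtCoeff_eq_sub]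
  rw [Finset.sum_range_sub' (fun n : ℕ => (n.centralBinom : ℝ) / 4 ^ n)]
  have : (0 : ℝ) ≤ N.centralBinom / 4 ^ N := by positivity
  simpa using this

theorem summable_sqrtCoeff : Summable sqrtCoeff :=
  summable_of_sum_range_le sqrtCoeff_nonneg sum_sqrtCoeff_le_one

theorem tsum_sqrtCoeff_le_one : ∑' n, sqrtCoeff n ≤ 1 :=
  Real.tsum_le_of_sum_range_le sqrtCoeff_nonneg sum_sqrtCoeff_le_one

theorem sum_antidiagonal_sqrtCoeff (n : ℕ) :
    ∑ p ∈ Finset.HasAntidiagonal.antidiagonal n, sqrtCoeff p.1 * sqrtCoeff p.2 = 2 * sqrtCoeff (n + 1) := by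
  have h : ∀ p ∈ Finset.HasAntidiagonal.antidiagonal n, sqrtCoeff p.1 * sqrtCoeff p.2 =
      4 / 4 ^ (n + 2) * ((catalan p.1 : ℝ) * catalan p.2) := by
    intro p hp
    rw [Finset.HasAntidiagonal.mem_antidiagonal] at hp
    rw [← hp, sqrtCoeff, sqrtCoeff]
    field_simp
    ring
  rw [Finset.sum_congr rfl h, ← Finset.mul_sum, sqrtCoeff, catalan_succ']
  push_cast
  ring

section Series

variable {𝕜 B : Type*} [RCLike 𝕜] [NormedRing B] [NormedAlgebra 𝕜 B]

variable (𝕜) in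
/-- The terms of the power series of `1 - √(1 - X)`. -/
noncomputable def sqrtTerm (X : B) (n : ℕ) : B := (sqrtCoeff n : 𝕜) • X ^ (n + 1)

theorem norm_sqrtTerm_le {X : B} (hX : ‖X‖ ≤ 1) (n : ℕ) : ‖sqrtTerm 𝕜 X n‖ ≤ sqrtCoeff n := by
  rw [sqrtTerm, norm_smul, RCLike.norm_ofReal, abs_of_nonneg (sqrtCoeff_nonneg n)]
  have : ‖X ^ (n + 1)‖ ≤ 1 :=
    (norm_pow_le' X n.succ_pos).trans (pow_le_one₀ (norm_nonneg _) hX)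
  exact mul_le_of_le_one_right (sqrtCoeff_nonneg n) this

theorem summable_norm_sqrtTerm {X : B} (hX : ‖X‖ ≤ 1) : Summable fun n => ‖sqrtTerm 𝕜 X n‖ :=
  summable_sqrtCoeff.of_nonneg_of_le (fun _ => norm_nonneg _) (norm_sqrtTerm_le hX)

theorem norm_tsum_sqrtTerm_le {X : B} (hX : ‖X‖ ≤ 1) : ‖∑' n, sqrtTerm 𝕜 X n‖ ≤ 1 :=
  (tsum_of_norm_bounded summable_sqrtCoeff.hasSum (norm_sqrtTerm_le hX)).trans
    tsum_sqrtCoeff_le_one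

theorem tsum_sqrtTerm_mul_self [CompleteSpace B] {X : B} (hX : ‖X‖ ≤ 1) :
    (1 - ∑' n, sqrtTerm 𝕜 X n) * (1 - ∑' n, sqrtTerm 𝕜 X n) = 1 - X := by
  have hs := summable_norm_sqrtTerm (𝕜 := 𝕜) hX
  have h1 : (∑' n, sqrtTerm 𝕜 X n) * (∑' n, sqrtTerm 𝕜 X n) =
      (2 : 𝕜) • ∑' n, sqrtTerm 𝕜 X (n + 1) := by
    rw [tsum_mul_tsum_eq_tsum_sum_antidiagonal_of_summable_norm hs hs, ← tsum_const_smul'']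
    refine tsum_congr fun n => ?_
    have h : ∀ p ∈ Finset.HasAntidiagonal.antidiagonal n, sqrtTerm 𝕜 X p.1 * sqrtTerm 𝕜 X p.2 =
        ((sqrtCoeff p.1 * sqrtCoeff p.2 : ℝ) : 𝕜) • X ^ (n + 2) := by
      intro p hp
      rw [Finset.HasAntidiagonal.mem_antidiagonal] at hp
      rw [sqrtTerm, sqrtTerm, smul_mul_smul_comm, ← pow_add, RCLike.ofReal_mul]
      congr 2
      omega
    rw [Finset.sum_congr rfl h, ← Finset.sum_smul, ← RCLike.ofReal_sum,
      sum_antidiagonal_sqrtCoeff, sqrtTerm, smul_smul]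
    push_cast
    rfl
  have h2 : ∑' n, sqrtTerm 𝕜 X n = (2⁻¹ : 𝕜) • X + ∑' n, sqrtTerm 𝕜 X (n + 1) := by
    rw [hs.of_norm.tsum_eq_zero_add]
    congr 1
    have : sqrtCoeff 0 = 2⁻¹ := by norm_num [sqrtCoeff]
    rw [sqrtTerm, this, zero_add, pow_one, RCLike.ofReal_inv, RCLike.ofReal_ofNat]
  have h3 : ∑' n, sqrtTerm 𝕜 X (n + 1) = ∑' n, sqrtTerm 𝕜 X n - (2⁻¹ : 𝕜) • X := by
    rw [h2]; abel
  rw [h3, smul_sub, smul_smul, mul_inv_cancel₀ two_ne_zero, one_smul, two_smul] at h1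
  rw [mul_sub, sub_mul, sub_mul, h1]
  simp only [one_mul, mul_one]
  abel

theorem commute_tsum_sqrtTerm [CompleteSpace B] {X C : B} (hX : ‖X‖ ≤ 1) (hC : Commute C X) :
    Commute C (∑' n, sqrtTerm 𝕜 X n) := by
  have hs := (summable_norm_sqrtTerm (𝕜 := 𝕜) hX).of_norm
  rw [commute_iff_eq, ← hs.tsum_mul_left, ← hs.tsum_mul_right]
  exact tsum_congr fun n => ((hC.pow_right (n + 1)).smul_right _).eq

end Series

section Bounded

variable {𝕜 H : Type*} [RCLike 𝕜] [NormedAddCommGroup H] [InnerProductSpace 𝕜 H]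

theorem norm_sq_le_of_isPositive {K : H →L[𝕜] H} (hK : K.IsPositive) {c : ℝ} (hc : 0 < c)
    (hKc : ‖K‖ ≤ c) (x : H) : ‖K x‖ ^ 2 ≤ c * RCLike.re (inner 𝕜 (K x) x) := by
  have h := hK.re_inner_nonneg_left (x - ((c⁻¹ : ℝ) : 𝕜) • K x)
  have e : RCLike.re (inner 𝕜 (K (K x)) x) = ‖K x‖ ^ 2 := by
    rw [hK.inner_left_eq_inner_right, inner_self_eq_norm_sq]
  have e' : RCLike.re (inner 𝕜 (K x) (K x)) = ‖K x‖ ^ 2 := inner_self_eq_norm_sq _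
  have b : RCLike.re (inner 𝕜 (K (K x)) (K x)) ≤ c * ‖K x‖ ^ 2 :=
    calc RCLike.re (inner 𝕜 (K (K x)) (K x)) ≤ ‖K (K x)‖ * ‖K x‖ := re_inner_le_norm _ _
      _ ≤ (c * ‖K x‖) * ‖K x‖ := by
        gcongr
        exact (K.le_opNorm _).trans (by gcongr)
      _ = c * ‖K x‖ ^ 2 := by ring
  simp only [map_sub, map_smul, inner_sub_left, inner_sub_right, inner_smul_left, inner_smul_right,
    RCLike.conj_ofReal, RCLike.re_ofReal_mul, e, e'] at h
  have b' : c⁻¹ * (c⁻¹ * RCLike.re (inner 𝕜 (K (K x)) (K x))) ≤ c⁻¹ * ‖K x‖ ^ 2 := by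
    gcongr
    rwa [inv_mul_le_iff₀ hc]
  have : c⁻¹ * ‖K x‖ ^ 2 ≤ RCLike.re (inner 𝕜 (K x) x) := by linarith
  rwa [inv_mul_le_iff₀ hc] at this

theorem eq_zero_of_isPositive_of_re_inner_eq_zero {K : H →L[𝕜] H} (hK : K.IsPositive) {x : H}
    (hx : RCLike.re (inner 𝕜 (K x) x) ≤ 0) : K x = 0 := by
  have h := norm_sq_le_of_isPositive hK (c := ‖K‖ + 1) (by positivity) (by linarith) x
  have : ‖K x‖ ^ 2 ≤ 0 := h.trans (mul_nonpos_of_nonneg_of_nonpos (by positivity) hx)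
  simpa using le_antisymm this (by positivity)

theorem norm_one_sub_smul_le {K : H →L[𝕜] H} (hK : K.IsPositive) {c : ℝ} (hc : 0 < c)
    (hKc : ‖K‖ ≤ c) : ‖1 - ((c⁻¹ : ℝ) : 𝕜) • K‖ ≤ 1 := by
  refine ContinuousLinearMap.opNorm_le_bound _ zero_le_one fun x => ?_
  have h := norm_sq_le_of_isPositive hK hc hKc x
  have hp := hK.re_inner_nonneg_left x
  rw [one_mul]
  refine abs_le_of_sq_le_sq' ?_ (norm_nonneg _) |>.2
  have e : ‖(1 - ((c⁻¹ : ℝ) : 𝕜) • K) x‖ ^ 2 =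
      ‖x‖ ^ 2 - 2 * (c⁻¹ * RCLike.re (inner 𝕜 (K x) x)) + c⁻¹ * (c⁻¹ * ‖K x‖ ^ 2) := by
    have : (1 - ((c⁻¹ : ℝ) : 𝕜) • K) x = x - ((c⁻¹ : ℝ) : 𝕜) • K x := rfl
    rw [this, norm_sub_sq (𝕜 := 𝕜), inner_smul_right, RCLike.re_ofReal_mul, norm_smul,
      ← hK.inner_left_eq_inner_right, RCLike.norm_ofReal, abs_of_pos (inv_pos.2 hc)]
    ring
  have : c⁻¹ * (c⁻¹ * ‖K x‖ ^ 2) ≤ c⁻¹ * RCLike.re (inner 𝕜 (K x) x) := by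
    gcongr
    rwa [inv_mul_le_iff₀ hc]
  have : 0 ≤ c⁻¹ * RCLike.re (inner 𝕜 (K x) x) := by positivity
  linarith

theorem isPositive_one_sub [CompleteSpace H] {Y : H →L[𝕜] H} (hYs : IsSelfAdjoint Y)
    (hY : ‖Y‖ ≤ 1) : (1 - Y).IsPositive := by
  rw [ContinuousLinearMap.isPositive_def']
  refine ⟨(IsSelfAdjoint.one _).sub hYs, fun x => ?_⟩
  have h1 : RCLike.re (inner 𝕜 (Y x) x) ≤ ‖x‖ ^ 2 :=
    calc RCLike.re (inner 𝕜 (Y x) x) ≤ ‖Y x‖ * ‖x‖ := re_inner_le_norm _ _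
      _ ≤ (1 * ‖x‖) * ‖x‖ := by
        gcongr
        exact (Y.le_opNorm x).trans (by gcongr)
      _ = ‖x‖ ^ 2 := by ring
  rw [ContinuousLinearMap.reApplyInnerSelf_apply]
  change 0 ≤ RCLike.re (inner 𝕜 (x - Y x) x)
  rw [inner_sub_left, map_sub, inner_self_eq_norm_sq]
  linarith

theorem isSelfAdjoint_tsum_sqrtTerm [CompleteSpace H] {X : H →L[𝕜] H} (hX : IsSelfAdjoint X) :
    IsSelfAdjoint (∑' n, sqrtTerm 𝕜 X n) := by
  rw [IsSelfAdjoint, tsum_star]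
  refine tsum_congr fun n => ?_
  rw [sqrtTerm, star_smul, star_pow, hX.star_eq, RCLike.star_def, RCLike.conj_ofReal]

theorem exists_isPositive_sqrt_one_sub [CompleteSpace H] {X : H →L[𝕜] H} (hXs : IsSelfAdjoint X)
    (hX : ‖X‖ ≤ 1) :
    ∃ R : H →L[𝕜] H, R.IsPositive ∧ R * R = 1 - X ∧
      ∀ C : H →L[𝕜] H, Commute C X → Commute C R :=
  ⟨1 - ∑' n, sqrtTerm 𝕜 X n,
    isPositive_one_sub (isSelfAdjoint_tsum_sqrtTerm hXs) (norm_tsum_sqrtTerm_le hX),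
    tsum_sqrtTerm_mul_self hX,
    fun C hC => (Commute.one_right C).sub_right (commute_tsum_sqrtTerm hX hC)⟩

/-- A bounded positive operator on a real or complex Hilbert space has a bounded positive square
root that commutes with everything that commutes with the operator. -/
theorem exists_isPositive_sqrt [CompleteSpace H] {K : H →L[𝕜] H} (hK : K.IsPositive) :
    ∃ R : H →L[𝕜] H, R.IsPositive ∧ R * R = K ∧ ∀ C : H →L[𝕜] H, Commute C K → Commute C R := by
  obtain ⟨c, hc, hKc⟩ : ∃ c : ℝ, 0 < c ∧ ‖K‖ ≤ c := ⟨‖K‖ + 1, by positivity, by linarith⟩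
  have hXs : IsSelfAdjoint (1 - ((c⁻¹ : ℝ) : 𝕜) • K) :=
    (IsSelfAdjoint.one _).sub (IsSelfAdjoint.smul (RCLike.conj_ofReal c⁻¹) hK.isSelfAdjoint)
  obtain ⟨R, hR, hRR, hRc⟩ :=
    exists_isPositive_sqrt_one_sub hXs (norm_one_sub_smul_le hK hc hKc)
  refine ⟨((√c : ℝ) : 𝕜) • R,
    hR.smul_of_nonneg (RCLike.ofReal_nonneg.2 (Real.sqrt_nonneg c)), ?_, fun C hC => ?_⟩
  · rw [smul_mul_smul_comm, hRR, sub_sub_cancel, smul_smul,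
      ← RCLike.ofReal_mul, ← RCLike.ofReal_mul, Real.mul_self_sqrt hc.le, mul_inv_cancel₀ hc.ne',
      RCLike.ofReal_one, one_smul]
  · exact (hRc C ((Commute.one_right C).sub_right (hC.smul_right _))).smul_right _

/-- Uniqueness of the bounded positive square root of an injective operator. -/
theorem isPositive_sqrt_unique [CompleteSpace H] {G R : H →L[𝕜] H} (hG : G.IsPositive)
    (hR : R.IsPositive) (hRi : Function.Injective R) (h : G * G = R * R) (hc : Commute G R) :
    G = R := by
  ext x
  have h0 : (R + G) (R x - G x) = 0 := by
    have : (R + G) * (R - G) = 0 := by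
      rw [mul_sub, add_mul, add_mul, h, hc.eq]; abel
    simpa using DFunLike.congr_fun this x
  set z := R x - G x
  have h1 : RCLike.re (inner 𝕜 (R z) z) + RCLike.re (inner 𝕜 (G z) z) = 0 := by
    rw [← map_add, ← inner_add_left, ← add_apply, h0, inner_zero_left, map_zero]
  have h2 : R z = 0 := eq_zero_of_isPositive_of_re_inner_eq_zero hR (by
    linarith [hG.re_inner_nonneg_left z])
  have h3 : z = 0 := hRi (by rw [h2, map_zero])
  exact (sub_eq_zero.1 h3).symm

end Bounded

end EPOperator

namespace EPOperator

section Graph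

theorem eq_zero_of_norm_sq_add_nonpos {E : Type*} [NormedAddCommGroup E] {x y : E}
    (h : ‖x‖ ^ 2 + ‖y‖ ^ 2 ≤ 0) : x = 0 ∧ y = 0 := by
  have hx : ‖x‖ ^ 2 ≤ 0 := by nlinarith [sq_nonneg ‖y‖]
  have hy : ‖y‖ ^ 2 ≤ 0 := by nlinarith [sq_nonneg ‖x‖]
  constructor
  · simpa using le_antisymm hx (sq_nonneg _)
  · simpa using le_antisymm hy (sq_nonneg _)

variable {𝕜 H : Type*} [RCLike 𝕜] [NormedAddCommGroup H] [InnerProductSpace 𝕜 H]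

theorem mem_graph_prod_iff {S T : H →ₗ.[𝕜] H} {x z : H} :
    (x, z) ∈ (prod S T).graph ↔ ∃ y, (x, y) ∈ T.graph ∧ (y, z) ∈ S.graph := by
  simp only [LinearPMap.mem_graph_iff]
  constructor
  · rintro ⟨⟨x', hx'⟩, rfl, rfl⟩
    obtain ⟨h, h'⟩ := (mem_prod_domain S T x').1 hx'
    exact ⟨T ⟨x', h⟩, ⟨⟨x', h⟩, rfl, rfl⟩, ⟨⟨_, h'⟩, rfl, rfl⟩⟩
  · rintro ⟨_, ⟨a, rfl, rfl⟩, ⟨b, hb, rfl⟩⟩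
    have hb' : T a ∈ S.domain := hb ▸ b.2
    refine ⟨⟨a, (mem_prod_domain S T a).2 ⟨a.2, hb'⟩⟩, rfl, ?_⟩
    rw [prod_apply S T _ a.2 hb']
    congr 1
    exact Subtype.ext hb.symm

theorem mem_range_iff {T : H →ₗ.[𝕜] H} {y : H} : y ∈ range T ↔ ∃ x, (x, y) ∈ T.graph := by
  simp [range, LinearPMap.mem_graph_iff]

theorem mem_range_of_mem_graph {T : H →ₗ.[𝕜] H} {x y : H} (h : (x, y) ∈ T.graph) : y ∈ range T :=
  mem_range_iff.2 ⟨x, h⟩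

theorem eq_of_forall_mem_graph_iff {S T : H →ₗ.[𝕜] H}
    (h : ∀ x y, (x, y) ∈ S.graph ↔ (x, y) ∈ T.graph) : S = T :=
  LinearPMap.eq_of_eq_graph (Submodule.ext fun p => h p.1 p.2)

variable [CompleteSpace H]

theorem mem_graph_adjoint_iff {T : H →ₗ.[𝕜] H} (hT : Dense (T.domain : Set H)) {u v : H} :
    (u, v) ∈ T†.graph ↔ ∀ x y, (x, y) ∈ T.graph → inner 𝕜 y u = inner 𝕜 x v := by
  rw [LinearPMap.adjoint_graph_eq_graph_adjoint hT, Submodule.mem_adjoint_iff]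
  simp only [sub_eq_zero]

theorem inner_eq_of_mem_graph {T : H →ₗ.[𝕜] H} (hT : Dense (T.domain : Set H)) {u v x y : H}
    (huv : (u, v) ∈ T†.graph) (hxy : (x, y) ∈ T.graph) : inner 𝕜 y u = inner 𝕜 x v :=
  (mem_graph_adjoint_iff hT).1 huv x y hxy

/-- The orthogonal decomposition of `H × H` into the graph of `A` and the rotated graph of `A†`. -/
theorem exists_graph_decomposition {A : H →ₗ.[𝕜] H} (hd : Dense (A.domain : Set H))
    (hc : A.IsClosed) (h k : H) :
    ∃ x y w z, (x, y) ∈ A.graph ∧ (w, z) ∈ A†.graph ∧ h = x + z ∧ k = y - w := by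
  set g : Submodule 𝕜 (WithLp 2 (H × H)) :=
    A.graph.comap (WithLp.linearEquiv 2 𝕜 (H × H)).toLinearMap with hg
  have hgc : IsClosed (g : Set (WithLp 2 (H × H))) :=
    IsClosed.preimage (WithLp.prod_continuous_ofLp 2 H H) hc
  have : CompleteSpace g := hgc.completeSpace_coe
  obtain ⟨p, hp, q, hq, hpq⟩ := g.exists_add_mem_mem_orthogonal (WithLp.toLp 2 (h, k))
  refine ⟨p.fst, p.snd, -q.snd, q.fst, hp, ?_, ?_, ?_⟩
  · rw [mem_graph_adjoint_iff hd]
    intro x y hxy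
    have h0 := (Submodule.mem_orthogonal _ _).1 hq (WithLp.toLp 2 (x, y)) hxy
    rw [WithLp.prod_inner_apply] at h0
    simp only [WithLp.ofLp_fst, WithLp.ofLp_snd] at h0
    rw [inner_neg_right]
    exact (eq_neg_of_add_eq_zero_left h0).symm
  · simpa using congrArg WithLp.fst hpq
  · simpa using congrArg WithLp.snd hpq

theorem dense_of_forall_inner_eq_zero {M : Submodule 𝕜 H}
    (h : ∀ y, (∀ x ∈ M, inner 𝕜 x y = 0) → y = 0) : Dense (M : Set H) := by
  rw [Submodule.dense_iff_topologicalClosure_eq_top, Submodule.topologicalClosure_eq_top_iff,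
    Submodule.eq_bot_iff]
  exact fun y hy => h y ((Submodule.mem_orthogonal _ _).1 hy)

theorem dense_domain_of_forall_mem_graph {T : H →ₗ.[𝕜] H}
    (h : ∀ z, (∀ x y, (x, y) ∈ T.graph → inner 𝕜 x z = 0) → z = 0) :
    Dense (T.domain : Set H) :=
  dense_of_forall_inner_eq_zero fun z hz =>
    h z fun _ _ hxy => hz _ (LinearPMap.mem_domain_of_mem_graph hxy)

theorem dense_domain_adjoint {A : H →ₗ.[𝕜] H} (hd : Dense (A.domain : Set H))
    (hc : A.IsClosed) : Dense (A†.domain : Set H) := by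
  refine dense_domain_of_forall_mem_graph fun k hk => ?_
  obtain ⟨x, y, w, z, hxy, hwz, h0, rfl⟩ := exists_graph_decomposition hd hc 0 k
  have hx : x = -z := eq_neg_of_add_eq_zero_left h0.symm
  have h1 := hk w z hwz
  have h2 := inner_eq_of_mem_graph hd hwz hxy
  rw [hx, inner_neg_left] at h2
  have h3 := congrArg RCLike.re h2
  rw [inner_sub_right, sub_eq_zero] at h1
  rw [map_neg, inner_self_eq_norm_sq, inner_re_symm, h1, inner_self_eq_norm_sq] at h3
  obtain ⟨rfl, rfl⟩ := eq_zero_of_norm_sq_add_nonpos (x := w) (y := z) (by linarith)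
  rw [hx, neg_zero] at hxy
  rw [A.graph_fst_eq_zero_snd hxy rfl, sub_zero]

/-- A densely defined closed operator is its own double adjoint. -/
theorem adjoint_adjoint_eq {A : H →ₗ.[𝕜] H} (hd : Dense (A.domain : Set H))
    (hc : A.IsClosed) : A†† = A := by
  have hd' := dense_domain_adjoint hd hc
  refine eq_of_forall_mem_graph_iff fun u v => ⟨fun huv => ?_, fun huv => ?_⟩
  · obtain ⟨x, y, w, z, hxy, hwz, rfl, rfl⟩ := exists_graph_decomposition hd hc u v
    have h1 := inner_eq_of_mem_graph hd' huv hwz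
    have h2 := inner_eq_of_mem_graph hd hwz hxy
    rw [inner_add_right, inner_sub_right, ← inner_conj_symm z x, ← h2, inner_conj_symm] at h1
    have h3 : RCLike.re (inner 𝕜 z z) = -RCLike.re (inner 𝕜 w w) := by
      have := congrArg RCLike.re h1
      simp only [map_add, map_sub] at this
      linarith
    rw [inner_self_eq_norm_sq, inner_self_eq_norm_sq] at h3
    obtain ⟨rfl, rfl⟩ := eq_zero_of_norm_sq_add_nonpos (x := w) (y := z) (by linarith)
    simpa using hxy
  · rw [mem_graph_adjoint_iff hd']
    intro w z hwz
    rw [← inner_conj_symm, ← inner_eq_of_mem_graph hd hwz huv, inner_conj_symm]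

end Graph

section Positive

variable {𝕜 H : Type*} [RCLike 𝕜] [NormedAddCommGroup H] [InnerProductSpace 𝕜 H]
  [CompleteSpace H]

theorem IsPositive.adjoint_eq {T : H →ₗ.[𝕜] H} (hT : IsPositive T) : T† = T :=
  hT.isSelfAdjoint

theorem IsPositive.dense_domain {T : H →ₗ.[𝕜] H} (hT : IsPositive T) :
    Dense (T.domain : Set H) :=
  hT.isSelfAdjoint.dense_domain

theorem IsPositive.mem_graph_iff {T : H →ₗ.[𝕜] H} (hT : IsPositive T) {u v : H} :
    (u, v) ∈ T.graph ↔ ∀ x y, (x, y) ∈ T.graph → inner 𝕜 y u = inner 𝕜 x v := by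
  have := mem_graph_adjoint_iff hT.dense_domain (u := u) (v := v)
  rwa [hT.adjoint_eq] at this

theorem IsPositive.inner_eq {T : H →ₗ.[𝕜] H} (hT : IsPositive T) {u v x y : H}
    (hxy : (x, y) ∈ T.graph) (huv : (u, v) ∈ T.graph) : inner 𝕜 y u = inner 𝕜 x v :=
  hT.mem_graph_iff.1 huv x y hxy

theorem IsPositive.re_inner_graph_nonneg {T : H →ₗ.[𝕜] H} (hT : IsPositive T) {x y : H}
    (hxy : (x, y) ∈ T.graph) : 0 ≤ RCLike.re (inner 𝕜 y x) := by
  obtain ⟨a, rfl, rfl⟩ := (LinearPMap.mem_graph_iff T).1 hxy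
  exact hT.re_inner_nonneg a

theorem IsPositive.isEP {T : H →ₗ.[𝕜] H} (hT : IsPositive T)
    (hr : IsClosed (range T : Set H)) : IsEP T :=
  ⟨hT.dense_domain, hT.isSelfAdjoint.isClosed, hr, by rw [hT.adjoint_eq]⟩

/-- A symmetric operator `T` with nonnegative form and `1 + T` onto is positive. -/
theorem isPositive_of_forall_exists_add {T : H →ₗ.[𝕜] H}
    (hs : ∀ x y u v, (x, y) ∈ T.graph → (u, v) ∈ T.graph → inner 𝕜 y u = inner 𝕜 x v)
    (hn : ∀ x y, (x, y) ∈ T.graph → 0 ≤ RCLike.re (inner 𝕜 y x))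
    (hr : ∀ h, ∃ x y, (x, y) ∈ T.graph ∧ h = x + y) : IsPositive T := by
  have hd : Dense (T.domain : Set H) := by
    refine dense_domain_of_forall_mem_graph fun h hh => ?_
    obtain ⟨x, y, hxy, rfl⟩ := hr h
    have h1 := congrArg RCLike.re (hh x y hxy)
    have h2 := hn x y hxy
    rw [inner_add_right, map_add, inner_self_eq_norm_sq, inner_re_symm, map_zero] at h1
    have hx : x = 0 := by
      have : ‖x‖ ^ 2 ≤ 0 := by linarith
      simpa using le_antisymm this (sq_nonneg _)
    subst hx
    rw [T.graph_fst_eq_zero_snd hxy rfl, zero_add]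
  refine ⟨?_, fun x => hn _ _ (T.mem_graph x)⟩
  rw [LinearPMap.isSelfAdjoint_def]
  refine eq_of_forall_mem_graph_iff fun u v => ⟨fun huv => ?_, fun huv => ?_⟩
  · obtain ⟨x, y, hxy, hsum⟩ := hr (u + v)
    obtain ⟨a, b, hab, hsub⟩ := hr (u - x)
    have h1 := inner_eq_of_mem_graph hd huv hab
    have h2 := hs a b x y hab hxy
    have h0 : inner 𝕜 (u - x) (u - x) = 0 := by
      have e : v - y = -(u - x) := by
        rw [← add_eq_zero_iff_eq_neg, ← sub_eq_zero.2 hsum]; abel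
      calc inner 𝕜 (u - x) (u - x) = inner 𝕜 (a + b) (u - x) := by rw [← hsub]
        _ = inner 𝕜 a (u - x) + inner 𝕜 a (v - y) := by
          rw [inner_add_left, inner_sub_right b, h1, h2, ← inner_sub_right]
        _ = 0 := by rw [e, inner_neg_right, add_neg_cancel]
    have hux : u = x := sub_eq_zero.1 (inner_self_eq_zero.1 h0)
    subst hux
    rwa [add_left_cancel hsum]
  · exact (mem_graph_adjoint_iff hd).2 fun x y hxy => hs x y u v hxy huv

/-- Von Neumann's theorem: `A† A` is positive for a densely defined closed operator `A`. -/
theorem isPositive_prod_adjoint_self {A : H →ₗ.[𝕜] H} (hd : Dense (A.domain : Set H))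
    (hc : A.IsClosed) : IsPositive (prod A† A) := by
  have key : ∀ x y u v, (x, y) ∈ (prod A† A).graph → (u, v) ∈ (prod A† A).graph →
      ∃ a b, (x, a) ∈ A.graph ∧ (u, b) ∈ A.graph ∧
        inner 𝕜 y u = inner 𝕜 a b ∧ inner 𝕜 x v = inner 𝕜 a b := by
    intro x y u v hxy huv
    obtain ⟨a, hxa, hay⟩ := mem_graph_prod_iff.1 hxy
    obtain ⟨b, hub, hbv⟩ := mem_graph_prod_iff.1 huv
    refine ⟨a, b, hxa, hub, ?_, (inner_eq_of_mem_graph hd hbv hxa).symm⟩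
    rw [← inner_conj_symm, ← inner_eq_of_mem_graph hd hay hub, inner_conj_symm]
  refine isPositive_of_forall_exists_add (fun x y u v hxy huv => ?_) (fun x y hxy => ?_)
    fun h => ?_
  · obtain ⟨a, b, -, -, h1, h2⟩ := key x y u v hxy huv
    rw [h1, h2]
  · obtain ⟨a, b, ha, hb, h1, -⟩ := key x y x y hxy hxy
    rw [h1, A.mem_graph_snd_inj ha hb rfl]
    exact inner_self_nonneg
  · obtain ⟨x, y, w, z, hxy, hwz, rfl, h0⟩ := exists_graph_decomposition hd hc h 0
    obtain rfl : y = w := sub_eq_zero.1 h0.symm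
    exact ⟨x, z, mem_graph_prod_iff.2 ⟨y, hxy, hwz⟩, rfl⟩

theorem range_prod_adjoint_self {A : H →ₗ.[𝕜] H} (hd : Dense (A.domain : Set H))
    (hr : IsClosed (range A : Set H)) : range (prod A† A) = range A† := by
  ext v
  constructor
  · intro hv
    obtain ⟨x, hx⟩ := mem_range_iff.1 hv
    obtain ⟨w, -, hw⟩ := mem_graph_prod_iff.1 hx
    exact mem_range_of_mem_graph hw
  · intro hv
    obtain ⟨u, hu⟩ := mem_range_iff.1 hv
    have : CompleteSpace (range A) := hr.completeSpace_coe
    obtain ⟨p, hp, q, hq, rfl⟩ := (range A).exists_add_mem_mem_orthogonal u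
    have hq0 : (q, 0) ∈ A†.graph := by
      rw [mem_graph_adjoint_iff hd]
      intro x y hxy
      rw [inner_zero_right]
      exact (Submodule.mem_orthogonal _ _).1 hq y (mem_range_of_mem_graph hxy)
    obtain ⟨x, hx⟩ := mem_range_iff.1 hp
    refine mem_range_iff.2 ⟨x, mem_graph_prod_iff.2 ⟨p, hx, ?_⟩⟩
    simpa using sub_mem hu hq0

theorem IsEP.adjoint {A : H →ₗ.[𝕜] H} (hA : IsEP A) : IsEP A† where
  dense_domain := dense_domain_adjoint hA.dense_domain hA.isClosed
  isClosed := LinearPMap.adjoint_isClosed hA.dense_domain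
  isClosed_range := hA.range_eq ▸ hA.isClosed_range
  range_eq := by rw [adjoint_adjoint_eq hA.dense_domain hA.isClosed, hA.range_eq]

theorem IsEP.prod_adjoint_self {A : H →ₗ.[𝕜] H} (hA : IsEP A) : IsEP (prod A† A) := by
  refine (isPositive_prod_adjoint_self hA.dense_domain hA.isClosed).isEP ?_
  rw [range_prod_adjoint_self hA.dense_domain hA.isClosed_range]
  exact hA.adjoint.isClosed_range

theorem IsEP.prod_self_adjoint {A : H →ₗ.[𝕜] H} (hA : IsEP A) : IsEP (prod A A†) := by
  have h := hA.adjoint.prod_adjoint_self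
  rwa [adjoint_adjoint_eq hA.dense_domain hA.isClosed] at h

end Positive

end EPOperator

namespace EPOperator

section ShiftedInverse

variable {𝕜 H : Type*} [RCLike 𝕜] [NormedAddCommGroup H] [InnerProductSpace 𝕜 H]

/-- `G` is a bounded positive inverse of `T + P`, where `P` is the projection onto the kernel
of `T`. -/
structure IsShiftedInverse (T : H →ₗ.[𝕜] H) (P G : H →L[𝕜] H) : Prop where
  isPositive : G.IsPositive
  injective : Function.Injective G
  mul_proj : G * P = P
  mem_graph_iff : ∀ x y, (x, y) ∈ T.graph ↔ x = G (y + P x)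

theorem IsShiftedInverse.apply_proj {T : H →ₗ.[𝕜] H} {P G : H →L[𝕜] H}
    (h : IsShiftedInverse T P G) (x : H) : G (P x) = P x :=
  DFunLike.congr_fun h.mul_proj x

/-- An operator is determined by its shifted inverse. -/
theorem IsShiftedInverse.eq {S T : H →ₗ.[𝕜] H} {P G : H →L[𝕜] H}
    (hS : IsShiftedInverse S P G) (hT : IsShiftedInverse T P G) : S = T :=
  eq_of_forall_mem_graph_iff fun x y => by rw [hS.mem_graph_iff, hT.mem_graph_iff]

/-- The linear map `x ↦ T x + P x`, defined on the graph of `T`. -/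
def shiftedMap (T : H →ₗ.[𝕜] H) (P : H →L[𝕜] H) : T.graph →ₗ[𝕜] H :=
  (LinearMap.snd 𝕜 H H + P.toLinearMap ∘ₗ LinearMap.fst 𝕜 H H) ∘ₗ T.graph.subtype

theorem shiftedMap_apply (T : H →ₗ.[𝕜] H) (P : H →L[𝕜] H) (p : T.graph) :
    shiftedMap T P p = p.1.2 + P p.1.1 := rfl

/-- A positive operator fixes the range of `P` if its square does. -/
theorem mul_proj_of_mul_self_mul_proj {P R : H →L[𝕜] H} (hR : R.IsPositive)
    (h : R * R * P = P) : R * P = P := by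
  ext x
  change R (P x) = P x
  have h0 : R (R (P x)) = P x := DFunLike.congr_fun h x
  set z := R (P x) - P x with hz
  have h1 : R z = -z := by rw [hz, map_sub, h0]; abel
  have h2 := hR.re_inner_nonneg_left z
  rw [h1, inner_neg_left, map_neg, inner_self_eq_norm_sq] at h2
  have h3 : ‖z‖ ^ 2 = 0 := le_antisymm (by linarith) (sq_nonneg _)
  exact sub_eq_zero.1 (by simpa using h3)

variable [CompleteSpace H]

theorem inner_proj_left {P : H →L[𝕜] H} (hP : IsStarProjection P) (x y : H) :
    inner 𝕜 (P x) y = inner 𝕜 x (P y) :=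
  hP.isSelfAdjoint.isSymmetric x y

theorem proj_proj {P : H →L[𝕜] H} (hP : IsStarProjection P) (x : H) : P (P x) = P x :=
  DFunLike.congr_fun hP.isIdempotentElem.eq x

theorem exists_isStarProjection_ker {M : Submodule 𝕜 H} (hM : IsClosed (M : Set H)) :
    ∃ P : H →L[𝕜] H, IsStarProjection P ∧ ∀ y, y ∈ M ↔ P y = 0 := by
  have : CompleteSpace M := hM.completeSpace_coe
  refine ⟨1 - M.starProjection, isStarProjection_starProjection.one_sub, fun y => ?_⟩
  change _ ↔ y - M.starProjection y = 0
  rw [sub_eq_zero, eq_comm, Submodule.starProjection_eq_self_iff]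

theorem IsPositive.proj_mem_graph {T : H →ₗ.[𝕜] H} (hT : IsPositive T) {P : H →L[𝕜] H}
    (hP : IsStarProjection P) (hr : ∀ y, y ∈ range T ↔ P y = 0) (x : H) :
    (P x, 0) ∈ T.graph := by
  rw [hT.mem_graph_iff]
  intro a b hab
  rw [← inner_proj_left hP, (hr b).1 (mem_range_of_mem_graph hab), inner_zero_left,
    inner_zero_right]

theorem IsPositive.bijective_shiftedMap {T : H →ₗ.[𝕜] H} (hT : IsPositive T) {P : H →L[𝕜] H}
    (hP : IsStarProjection P) (hr : ∀ y, y ∈ range T ↔ P y = 0) :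
    Function.Bijective (shiftedMap T P) := by
  constructor
  · rw [← LinearMap.ker_eq_bot, LinearMap.ker_eq_bot']
    rintro ⟨⟨x, y⟩, hxy⟩ h
    rw [shiftedMap_apply] at h
    dsimp only at h
    have hy : P y = 0 := (hr y).1 (mem_range_of_mem_graph hxy)
    have hx : P x = 0 := by
      have := congrArg P h
      rwa [map_add, hy, zero_add, proj_proj hP, map_zero] at this
    rw [hx, add_zero] at h
    subst h
    obtain ⟨z, hz⟩ := mem_range_iff.1 ((hr x).2 hx)
    have := hT.inner_eq hz hxy
    rw [inner_zero_right, inner_self_eq_zero] at this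
    subst this
    rfl
  · intro h
    have hm : h - P h ∈ range T := (hr _).2 (by rw [map_sub, proj_proj hP, sub_self])
    obtain ⟨x, hx⟩ := mem_range_iff.1 hm
    have hx' : (x - P x + P h, h - P h) ∈ T.graph := by
      simpa using add_mem (sub_mem hx (hT.proj_mem_graph hP hr x)) (hT.proj_mem_graph hP hr h)
    refine ⟨⟨_, hx'⟩, ?_⟩
    rw [shiftedMap_apply]
    simp [proj_proj hP]

theorem IsPositive.exists_isShiftedInverse {T : H →ₗ.[𝕜] H} (hT : IsPositive T) {P : H →L[𝕜] H}
    (hP : IsStarProjection P) (hr : ∀ y, y ∈ range T ↔ P y = 0) :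
    ∃ G : H →L[𝕜] H, IsShiftedInverse T P G := by
  obtain ⟨e, he⟩ : ∃ e : T.graph ≃ₗ[𝕜] H, ∀ p, e p = p.1.2 + P p.1.1 :=
    ⟨LinearEquiv.ofBijective (shiftedMap T P) (hT.bijective_shiftedMap hP hr), fun p => rfl⟩
  set G₀ : H →ₗ[𝕜] H := LinearMap.fst 𝕜 H H ∘ₗ T.graph.subtype ∘ₗ e.symm.toLinearMap with hG₀
  have hG : ∀ p : T.graph, G₀ (p.1.2 + P p.1.1) = p.1.1 := by
    intro p
    rw [← he]
    simp [hG₀]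
  have hsurj : ∀ h, ∃ x y, (x, y) ∈ T.graph ∧ y + P x = h ∧ G₀ h = x := by
    intro h
    obtain ⟨⟨⟨x, y⟩, hxy⟩, rfl⟩ := e.surjective h
    exact ⟨x, y, hxy, (he ⟨(x, y), hxy⟩).symm, by rw [he]; exact hG ⟨(x, y), hxy⟩⟩
  have hsymm : G₀.IsSymmetric := by
    intro h k
    obtain ⟨x, y, hxy, rfl, hx⟩ := hsurj h
    obtain ⟨u, v, huv, rfl, hu⟩ := hsurj k
    rw [hx, hu, inner_add_left, inner_add_right, hT.inner_eq hxy huv, inner_proj_left hP]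
  have hpos : (⟨G₀, hsymm.continuous⟩ : H →L[𝕜] H).IsPositive := by
    refine ⟨hsymm, fun h => ?_⟩
    obtain ⟨x, y, hxy, rfl, hx⟩ := hsurj h
    change 0 ≤ RCLike.re (inner 𝕜 (G₀ (y + P x)) (y + P x))
    have h1 := hT.re_inner_graph_nonneg hxy
    rw [inner_re_symm] at h1
    rw [hx, inner_add_right, map_add, ← proj_proj hP x, ← inner_proj_left hP,
      inner_self_eq_norm_sq]
    positivity
  refine ⟨⟨G₀, hsymm.continuous⟩, hpos, ?_, ?_, fun x y => ⟨fun hxy => ?_, fun hxy => ?_⟩⟩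
  · rw [injective_iff_map_eq_zero]
    intro h hh
    obtain ⟨x, y, hxy, rfl, hx⟩ := hsurj h
    obtain rfl : x = 0 := hx.symm.trans hh
    rw [T.graph_fst_eq_zero_snd hxy rfl, map_zero, add_zero]
  · ext x
    simpa [proj_proj hP] using hG ⟨_, hT.proj_mem_graph hP hr x⟩
  · exact (hG ⟨(x, y), hxy⟩).symm
  · obtain ⟨u, v, huv, hsum, hu⟩ := hsurj (y + P x)
    obtain rfl : x = u := hxy.trans hu
    rwa [← add_right_cancel hsum]

namespace IsShiftedInverse

variable {S T : H →ₗ.[𝕜] H} {P G K : H →L[𝕜] H}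

theorem proj_apply (h : IsShiftedInverse T P G) (hP : IsStarProjection P) (x : H) :
    P (G x) = P x := by
  refine ext_inner_right 𝕜 fun y => ?_
  rw [inner_proj_left hP, h.isPositive.inner_left_eq_inner_right, h.apply_proj, inner_proj_left hP]

theorem mem_graph (h : IsShiftedInverse T P G) (hP : IsStarProjection P) (w : H) :
    (G w, w - P w) ∈ T.graph := by
  rw [h.mem_graph_iff, h.proj_apply hP, sub_add_cancel]

theorem exists_of_mem_graph (h : IsShiftedInverse T P G) (hP : IsStarProjection P) {x y : H}
    (hxy : (x, y) ∈ T.graph) : ∃ w, x = G w ∧ y = w - P w := by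
  have hx := (h.mem_graph_iff x y).1 hxy
  refine ⟨y + P x, hx, ?_⟩
  rw [← h.proj_apply hP (y + P x), ← hx, add_sub_cancel_right]

theorem inverse_eq (hP : IsStarProjection P) (hG : IsShiftedInverse T P G)
    (hK : IsShiftedInverse T P K) : G = K := by
  ext w
  have := (hK.mem_graph_iff _ _).1 (hG.mem_graph hP w)
  rwa [hG.proj_apply hP, sub_add_cancel] at this

theorem prod_self (hP : IsStarProjection P) (h : IsShiftedInverse S P G) :
    IsShiftedInverse (prod S S) P (G * G) where
  isPositive := by
    have := ContinuousLinearMap.isPositive_self_comp_adjoint G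
    rwa [← ContinuousLinearMap.star_eq_adjoint, h.isPositive.isSelfAdjoint.star_eq] at this
  injective := h.injective.comp h.injective
  mul_proj := by rw [mul_assoc, h.mul_proj, h.mul_proj]
  mem_graph_iff x y := by
    rw [mem_graph_prod_iff]
    constructor
    · rintro ⟨w, hxw, hwy⟩
      obtain ⟨a, rfl, rfl⟩ := h.exists_of_mem_graph hP hxw
      have e := (h.mem_graph_iff _ _).1 hwy
      rw [map_sub, proj_proj hP, sub_self, add_zero] at e
      change G a = G (G (y + P (G a)))
      rw [h.proj_apply hP, map_add G, ← e, h.apply_proj, sub_add_cancel]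
    · intro hx
      change x = G (G (y + P x)) at hx
      have hPx : P y = 0 := by
        have := congrArg P hx
        rw [h.proj_apply hP, h.proj_apply hP, map_add, proj_proj hP] at this
        simpa using this
      refine ⟨G y, ?_, ?_⟩
      · rw [h.mem_graph_iff]
        rw [map_add, h.apply_proj] at hx
        exact hx
      · have := h.mem_graph hP y
        rwa [hPx, sub_zero] at this

end IsShiftedInverse

theorem exists_isPositive_isShiftedInverse {P R : H →L[𝕜] H} (hP : IsStarProjection P)
    (hR : R.IsPositive) (hRi : Function.Injective R) (hRP : R * P = P) :
    ∃ S : H →ₗ.[𝕜] H, IsPositive S ∧ IsShiftedInverse S P R := by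
  have hRP' : ∀ x, R (P x) = P x := fun x => DFunLike.congr_fun hRP x
  have hPR : ∀ x, P (R x) = P x := fun x => by
    refine ext_inner_right 𝕜 fun y => ?_
    rw [inner_proj_left hP, hR.inner_left_eq_inner_right, hRP', inner_proj_left hP]
  set g : Submodule 𝕜 (H × H) :=
    LinearMap.range (R.toLinearMap.prod (1 - P : H →L[𝕜] H).toLinearMap) with hg
  have hmem : ∀ x y, (x, y) ∈ g ↔ ∃ w, R w = x ∧ w - P w = y := by
    intro x y
    simp [hg, LinearMap.mem_range]
  have hgr : g.toLinearPMap.graph = g := by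
    refine Submodule.toLinearPMap_graph_eq g ?_
    rintro ⟨x, y⟩ hxy (rfl : x = 0)
    obtain ⟨w, hw, rfl⟩ := (hmem _ _).1 hxy
    obtain rfl : w = 0 := hRi (by rw [hw, map_zero])
    simp
  have hgraph : ∀ x y, (x, y) ∈ g.toLinearPMap.graph ↔ ∃ w, R w = x ∧ w - P w = y := by
    rw [hgr]; exact hmem
  have hinv : IsShiftedInverse g.toLinearPMap P R := by
    refine ⟨hR, hRi, hRP, fun x y => ?_⟩
    rw [hgraph]
    constructor
    · rintro ⟨w, rfl, rfl⟩
      rw [hPR, sub_add_cancel]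
    · intro hx
      refine ⟨y + P x, hx.symm, ?_⟩
      rw [← hPR (y + P x), ← hx, add_sub_cancel_right]
  have hd : Dense (g.toLinearPMap.domain : Set H) := by
    refine dense_domain_of_forall_mem_graph fun z hz => ?_
    have h1 := hz _ _ ((hgraph _ _).2 ⟨R z, rfl, rfl⟩)
    rw [hR.inner_left_eq_inner_right, inner_self_eq_zero] at h1
    exact hRi (by rw [h1, map_zero])
  refine ⟨g.toLinearPMap, ⟨?_, fun x => ?_⟩, hinv⟩
  · rw [LinearPMap.isSelfAdjoint_def]
    refine eq_of_forall_mem_graph_iff fun u v => ?_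
    rw [mem_graph_adjoint_iff hd, hinv.mem_graph_iff, map_add, hRP', ← sub_eq_iff_eq_add]
    have hl : ∀ w, inner 𝕜 (w - P w) u = inner 𝕜 w (u - P u) := fun w => by
      rw [inner_sub_left, inner_sub_right, inner_proj_left hP]
    constructor
    · intro h
      refine ext_inner_left 𝕜 fun w => ?_
      rw [← hl, h _ _ ((hgraph _ _).2 ⟨w, rfl, rfl⟩), hR.inner_left_eq_inner_right]
    · intro h x y hxy
      obtain ⟨w, rfl, rfl⟩ := (hgraph _ _).1 hxy
      rw [hl, h, hR.inner_left_eq_inner_right]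
  · obtain ⟨w, hx, hy⟩ := (hgraph _ _).1 (g.toLinearPMap.mem_graph x)
    rw [← hx, ← hy]
    have h0 : inner 𝕜 (w - P w) (R (P w)) = 0 := by
      rw [hRP', ← inner_proj_left hP, map_sub, proj_proj hP, sub_self, inner_zero_left]
    have h1 : inner 𝕜 (w - P w) (R w) = inner 𝕜 (w - P w) (R (w - P w)) := by
      rw [map_sub R, inner_sub_right _ (R w), h0, sub_zero]
    rw [h1]
    exact hR.re_inner_nonneg_right _

theorem range_eq_of_prod_self_eq {S T : H →ₗ.[𝕜] H} (hS : IsPositive S) (hT : IsPositive T)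
    (h : prod S S = T) (hr : IsClosed (range T : Set H)) : range S = range T := by
  obtain ⟨P, hP, hPr⟩ := exists_isStarProjection_ker hr
  ext y
  constructor
  · intro hy
    obtain ⟨x, hxy⟩ := mem_range_iff.1 hy
    have h0 := hT.proj_mem_graph hP hPr y
    rw [← h, mem_graph_prod_iff] at h0
    obtain ⟨w, hw, hw0⟩ := h0
    have hww := hS.inner_eq hw hw0
    rw [inner_zero_right, inner_self_eq_zero] at hww
    subst hww
    have h1 := hS.inner_eq hxy hw
    rw [inner_zero_right, ← proj_proj hP, ← inner_proj_left hP, inner_self_eq_zero] at h1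
    exact (hPr y).2 h1
  · intro hy
    obtain ⟨x, hx⟩ := mem_range_iff.1 hy
    rw [← h, mem_graph_prod_iff] at hx
    obtain ⟨w, -, hw⟩ := hx
    exact mem_range_of_mem_graph hw

/-- A positive operator with closed range has exactly one positive square root. -/
theorem IsPositive.existsUnique_sqrt {T : H →ₗ.[𝕜] H} (hT : IsPositive T)
    (hr : IsClosed (range T : Set H)) : ∃! S : H →ₗ.[𝕜] H, IsPositiveSqrt S T := by
  obtain ⟨P, hP, hPr⟩ := exists_isStarProjection_ker hr
  obtain ⟨K, hK⟩ := hT.exists_isShiftedInverse hP hPr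
  obtain ⟨R, hR, hRR, hRc⟩ := exists_isPositive_sqrt hK.isPositive
  have hRi : Function.Injective R := by
    refine Function.Injective.of_comp (f := R) ?_
    have := hK.injective
    rwa [← hRR] at this
  have hRP : R * P = P := mul_proj_of_mul_self_mul_proj hR (by rw [hRR, hK.mul_proj])
  obtain ⟨S, hS, hSR⟩ := exists_isPositive_isShiftedInverse hP hR hRi hRP
  refine ⟨S, ⟨hS, ?_⟩, fun S' hS' => ?_⟩
  · have := hSR.prod_self hP
    rw [hRR] at this
    exact this.eq hK
  · have hr' := range_eq_of_prod_self_eq hS'.isPositive hT hS'.prod_self hr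
    obtain ⟨G, hG⟩ := hS'.isPositive.exists_isShiftedInverse hP (hr'.symm ▸ hPr)
    have hGG := hG.prod_self hP
    rw [hS'.prod_self] at hGG
    have hGK : G * G = K := hGG.inverse_eq hP hK
    have hc : Commute G R := hRc G (by rw [← hGK]; exact (Commute.refl G).mul_right (Commute.refl G))
    have hGR : G = R := isPositive_sqrt_unique hG.isPositive hR hRi (hGK.trans hRR.symm) hc
    exact (hGR ▸ hG).eq hSR

end ShiftedInverse

end EPOperator

theorem mainTheorem5 {𝕜 H : Type*} [RCLike 𝕜] [NormedAddCommGroup H] [InnerProductSpace 𝕜 H]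
    [CompleteSpace H] (A : H →ₗ.[𝕜] H) (hA : EPOperator.IsEP A) :
    EPOperator.IsEP A† ∧
    EPOperator.IsEP (EPOperator.prod A A†) ∧
    EPOperator.IsEP (EPOperator.prod A† A) ∧
    -- the modulus of `A` is well defined, and it is EP
    (∃! S : H →ₗ.[𝕜] H, EPOperator.IsModulus S A) ∧
    (∀ S : H →ₗ.[𝕜] H, EPOperator.IsModulus S A → EPOperator.IsEP S) := by
  have hT := EPOperator.isPositive_prod_adjoint_self hA.dense_domain hA.isClosed
  have hr := hA.prod_adjoint_self.isClosed_range
  refine ⟨hA.adjoint, hA.prod_self_adjoint, hA.prod_adjoint_self, hT.existsUnique_sqrt hr,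
    fun S hS => hS.isPositive.isEP ?_⟩
  rwa [EPOperator.range_eq_of_prod_self_eq hS.isPositive hT hS.prod_self hr]
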